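/- **Programs.** A RefJava program consists of a finite class table (classes and interfaces with their superclass, interfaces, instance fields and methods; this is the closed world) and the body of an entry method. Bodies are control-flow graphs with nondeterministic branching over the statements $x=\mathtt{new}\ t()$, $x=y$, $x=y.f$, $x.f=y$, $x=y.m(\ldots)$, string-constant loads, array allocation/load/store, casts $x=(A)\,y$, and the seven reflective calls $\mathtt{Class.forName}$, $\mathtt{getMethod}$, $\mathtt{getField}$, $\mathtt{newInstance}$, $x=(A)\,m.\mathtt{invoke}(y,args)$, $x=(A)\,f.\mathtt{get}(y)$, $f.\mathtt{set}(y,x)$. They are executed by the usual small-step semantics: $\mathtt{forName}$ returns the class of the closed world with the given name, casts that fail do not continue, reflective members are instance members, and an allocation creates an object with null fields (constructors are not part of an allocation). Let $<:$ denote subtyping, and for a type $A\ne\mathtt{Object}$ let $t\ll:A$ mean $t<:A$ or $A<:t$; for $A=\mathtt{Object}$ only the unknown $u$ satisfies $u\ll:\mathtt{Object}$. Program points serve as allocation sites and call sites. **Analysis.** SOLAR is the least fixed point of the following flow- and context-insensitive rules on points-to sets $pt(\cdot)$. Abstract objects are $o_i^t$ (allocated at site $i$ with class $t$), $c^t$,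 $m^t_s$, $f^t_s$ (Class, Method and Field objects), where $t$, and any part of the signature $s$, may be the unknown $u$. (i) Andersen's rules for allocation, copy, load, store and virtual call, array elements being collapsed; a cast is a copy, except that a cast to a type other than $\mathtt{Object}$ blocks objects $o_i^u$; on $o_i^u$ only $\mathtt{toString}$ (giving a non-constant string) and $\mathtt{getClass}$ (giving $c^u$) can be called. (ii) Propagation: $\mathtt{forName}$ yields $c^t$ for a string constant naming $t$ and $c^u$ for a string object that is not a constant; $\mathtt{getMethod}$ and $\mathtt{getField}$ on $c^t$ ($t$ possibly $u$) yield $m^t_s$ and $f^t_s$, where at most the name in $s$ is known, namely if the name argument is a string constant. (iii) Collective inference, adding at side-effect calls: $m^t_s$, $f^t_s$ for $m^u_s$, $f^u_s$ and each class $t$ of an object in $pt(y)$; for Method or Field objects with unknown signature, the signatures suggested by the cast ($\ll: A$) and by the classes of the arguments or of the stored value; and, for a member object of unknown class with known name at a call whose receiver may have unknown type, all classes that define a member with a so completed signature. (iv) Target search: $MTD(m^t_s)$ ($FLD(f^t_s)$) is the set of methods (fields) declared in a supertype of $t$ (including $t$) that match $s$, unknown parts being wild cards. (v) Transformation: for every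 $m^t_s\in pt(m)$ and $m'\in MTD(m^t_s)$, $m.\mathtt{invoke}(y,args)$ becomes a call $x=y.m'(arg_1,\ldots,arg_n)$, where $pt(arg_k)$ receives the elements of $args$ whose class is a subtype of the $k$-th parameter type; for every $f^t_s\in pt(f)$ and $f'\in FLD(f^t_s)$, $\mathtt{get}$ and $\mathtt{set}$ become $x=y.f'$ and $y.f'=x$. (vi) $i: o=c.\mathtt{newInstance}()$ adds $o_i^t$ to $pt(o)$ for every $c^t\in pt(c)$. Lazy heap modeling (LHM): it adds $o_i^u$ if $c^u\in pt(c)$; an $o_i^u$ reaching a cast $a=(A)\,x$ with $A\neq\mathtt{Object}$ adds $o_i^t$ to $pt(a)$ for all $t<:A$; an $o_i^u$ in $pt(y)$ at a side-effect call on a Method or Field object of known class $t$ adds $o_i^{t'}$ to $pt(y)$ for all $t'\ll:t$. The elements of an argument array are known to the inference of (iii) only where some intra-procedural analysis (arbitrary, but fixed) determines them. **Lemma.** Let RefJava$_c$ be the set of RefJava programs in which $cName$ is a string constant in every call $\mathtt{Class.forName}(cName)$, i.e. $cName$ is only assigned string constants (possibly through copies) or, more generally, all string objects in $pt(cName)$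 are string constants. Then for every program in RefJava$_c$: 1. SOLAR is sound. In every reachable state, the points-to sets over-approximate the values of all local variables (in all stack frames), object fields and array elements; an object created at site $i$ with dynamic class $t$ is represented by $o_i^t$, a Class object for $t$ by $c^t$, a Method object for a method $m'$ by some $m^t_s$ with $m'\in MTD(m^t_s)$, a Field object for $f'$ by some $f^t_s$ with $f'\in FLD(f^t_s)$. Every call executed, ordinary or reflective, is in the computed call graph. Whenever $\mathtt{newInstance}()$ on $c$ creates an instance of $t$, $c^t\in pt(c)$; whenever $m.\mathtt{invoke}(\ldots)$ is executed on a target method $m'$, $m'\in MTD(m^t_s)$ for some $m^t_s\in pt(m)$ with $t$ known; whenever $f.\mathtt{get}(\ldots)$ or $f.\mathtt{set}(\ldots)$ accesses a field $f'$, $f'\in FLD(f^t_s)$ for some $f^t_s\in pt(f)$ with $t$ known. 2. LHM is not needed: no points-to set contains an object $o_i^u$, $c^u$, $m^u_s$ or $f^u_s$, and the analysis without the LHM rules computes exactly the same facts. 3. Every call $i: o=c.\mathtt{newInstance}()$ amounts to the set of ordinary allocations $i: o=\mathtt{new}\ t()$ with $c^t\in pt(c)$: for each such $t$, $o_i^t\in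 pt(o)$, and every abstract object of site $i$ in any points-to set is such an $o_i^t$. -/

import Mathlib

namespace RefJava

/-! ## Programs -/

/-- Java strings, class names and member names.  The names that have a meaning for the language
are listed; every other string is a `text`. -/
inductive Str where
  | javaLangObject
  | javaLangString
  | javaLangClass
  | javaLangReflectMethod
  | javaLangReflectField
  | toStringName
  | getClassName
  | text (s : String)
  deriving DecidableEq

/-- Class types are given by their names (array types are classes of the class table, too). -/
abbrev ClassName := Str

/-- A field: declaring class, field type, name. -/
structure Field where
  decl : ClassName
  type : ClassName
  name : Str
  deriving DecidableEq

/-- A method: declaring class, return type, name, parameter types. -/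
structure Method where
  decl : ClassName
  ret : ClassName
  name : Str
  params : List ClassName
  deriving DecidableEq

/-- Local variables of a method.  `ret` is the pseudo-variable holding the return value. -/
inductive Local where
  | this
  | param (k : ℕ)
  | ret
  | tmp (n : ℕ)
  deriving DecidableEq

/-- Statements. -/
inductive Stmt where
  /-- `x = new t()`; for `t = String` it stands for any computation of a non-constant string -/
  | new (x : Local) (t : ClassName)
  /-- `x = y` -/
  | copy (x y : Local)
  /-- `x = y.f` -/
  | load (x y : Local) (f : Field)
  /-- `x.f = y` -/
  | store (x : Local) (f : Field) (y : Local)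
  /-- `x = y.m(args)` -/
  | call (x y : Local) (m : Method) (args : List Local)
  /-- `x = v` where `v` is a string constant -/
  | lit (x : Local) (v : Str)
  /-- allocation of an array of class `t` -/
  | newArr (x : Local) (t : ClassName)
  /-- `x = y[_]` -/
  | aload (x y : Local)
  /-- `x[_] = y` -/
  | astore (x y : Local)
  /-- `x = (A) y` -/
  | cast (x : Local) (A : ClassName) (y : Local)
  /-- `c = Class.forName(cName)` -/
  | forName (c cName : Local)
  /-- `m = c.getMethod(mName, ps)` -/
  | getMethod (m c mName : Local) (ps : List Local)
  /-- `f = c.getField(fName)` -/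
  | getField (f c fName : Local)
  /-- `o = c.newInstance()` -/
  | newInstance (o c : Local)
  /-- `x = (A) m.invoke(y, args)` -/
  | invoke (x : Local) (A : ClassName) (m y args : Local)
  /-- `x = (A) f.get(y)` -/
  | get (x : Local) (A : ClassName) (f y : Local)
  /-- `f.set(y, x)` -/
  | set (f y x : Local)

/-- The variable assigned by a statement. -/
def Stmt.def? : Stmt → Option Local
  | .new x _ => some x
  | .copy x _ => some x
  | .load x _ _ => some x
  | .store _ _ _ => none
  | .call x _ _ _ => some x
  | .lit x _ => some x
  | .newArr x _ => some x
  | .aload x _ => some x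
  | .astore _ _ => none
  | .cast x _ _ => some x
  | .forName c _ => some c
  | .getMethod m _ _ _ => some m
  | .getField f _ _ => some f
  | .newInstance o _ => some o
  | .invoke x _ _ _ _ => some x
  | .get x _ _ _ => some x
  | .set _ _ _ => none

/-- A node of a control-flow graph: a statement and the positions at which execution may go on.
Branch conditions are abstracted to a free choice; a position outside the body is the exit. -/
structure Instr where
  stmt : Stmt
  next : List ℕ

structure MethodDecl where
  ret : ClassName
  name : Str
  params : List ClassName
  /-- `none` for an abstract method -/
  body : Option (List Instr)

structure FieldDecl where
  type : ClassName
  name : Str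

structure ClassDecl where
  name : ClassName
  /-- interfaces and abstract classes, which have no instances of their own -/
  isAbstract : Bool
  super : Option ClassName
  interfaces : List ClassName
  fields : List FieldDecl
  methods : List MethodDecl

/-- A program: the classes of the closed world, and the body of the (static) entry method. -/
structure Program where
  classes : List ClassDecl
  main : List Instr

inductive Scope where
  | main
  | meth (m : Method)
  deriving DecidableEq

/-- A program point; allocation sites and call sites are identified by their program points. -/
abbrev Site := Scope × ℕ

namespace Program

variable (P : Program)

def find (t : ClassName) : Option ClassDecl := P.classes.find? (fun cd => cd.name == t)

/-- `t` extends or implements `t'` directly. -/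
def DirectSuper (t t' : ClassName) : Prop :=
  ∃ cd, P.find t = some cd ∧ (cd.super = some t' ∨ t' ∈ cd.interfaces)

/-- `t <: t'` -/
def Sub (t t' : ClassName) : Prop := Relation.ReflTransGen P.DirectSuper t t'

/-- The relation `t ≪: A`, where `none` is the unknown type. -/
def CastRel (t : Option ClassName) (A : ClassName) : Prop :=
  if A = Str.javaLangObject then t = none
  else ∃ t₀, t = some t₀ ∧ (P.Sub t₀ A ∨ P.Sub A t₀)

/-- `m` is declared in the class `m.decl`. -/
def DeclaresMethod (m : Method) : Prop :=
  ∃ cd, P.find m.decl = some cd ∧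
    ∃ md ∈ cd.methods, md.ret = m.ret ∧ md.name = m.name ∧ md.params = m.params

/-- `f` is declared in the class `f.decl`. -/
def DeclaresField (f : Field) : Prop :=
  ∃ cd, P.find f.decl = some cd ∧ ∃ fd ∈ cd.fields, fd.type = f.type ∧ fd.name = f.name

/-- The body of a method (or of the entry method). -/
def body : Scope → Option (List Instr)
  | .main => some P.main
  | .meth m =>
    (P.find m.decl).bind fun cd =>
      (cd.methods.find? fun md =>
        md.ret == m.ret && md.name == m.name && md.params == m.params).bind MethodDecl.body

def instrAt (i : Site) : Option Instr := (P.body i.1).bind fun b => b[i.2]?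

def stmtAt (i : Site) : Option Stmt := (P.instrAt i).map Instr.stmt

/-- The first class with the property `q` in a depth-first bottom-up search from `t` along
`supers`.  The number bounds the depth of the search. -/
def search (supers : ClassDecl → List ClassName) (q : ClassDecl → Bool) :
    ℕ → ClassName → Option ClassName
  | 0, _ => none
  | n + 1, t =>
    match P.find t with
    | none => none
    | some cd => if q cd then some t else (supers cd).findSome? (search supers q n)

/-- Search for a method: the class itself, then its superclasses, then its interfaces. -/
def methodHome (t : ClassName) (q : ClassDecl → Bool) : Option ClassName :=
  P.search (fun cd => cd.super.toList ++ cd.interfaces) q (P.classes.length + 1) t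

/-- Search for a field: the class itself, then its interfaces, then its superclasses. -/
def fieldHome (t : ClassName) (q : ClassDecl → Bool) : Option ClassName :=
  P.search (fun cd => cd.interfaces ++ cd.super.toList) q (P.classes.length + 1) t

/-- Search in the class itself and its superclasses. -/
def classHome (t : ClassName) (q : ClassDecl → Bool) : Option ClassName :=
  P.search (fun cd => cd.super.toList) q (P.classes.length + 1) t

/-- The method object returned by `getMethod(n, ps)` on the class `t`. -/
def GetMethod (t : ClassName) (n : Str) (ps : List ClassName) (m : Method) : Prop :=
  P.methodHome t (fun cd => cd.methods.any fun md => md.name == n && md.params == ps) =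
      some m.decl ∧
    P.DeclaresMethod m ∧ m.name = n ∧ m.params = ps

/-- The field object returned by `getField(n)` on the class `t`. -/
def GetField (t : ClassName) (n : Str) (f : Field) : Prop :=
  P.fieldHome t (fun cd => cd.fields.any fun fd => fd.name == n) = some f.decl ∧
    P.DeclaresField f ∧ f.name = n

/-- `m'` is an inherited interface method with a body that has the signature of `m`. -/
def DefaultFor (t : ClassName) (m m' : Method) : Prop :=
  P.Sub t m'.decl ∧ (P.body (.meth m')).isSome ∧
    m'.ret = m.ret ∧ m'.name = m.name ∧ m'.params = m.params

/-- Virtual dispatch of `m` on a receiver of class `t`: the first declaration with the signature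
of `m` along the superclass chain, otherwise a maximally specific interface method. -/
def Dispatch (t : ClassName) (m m' : Method) : Prop :=
  let q : ClassDecl → Bool := fun cd =>
    cd.methods.any fun md => md.ret == m.ret && md.name == m.name && md.params == m.params
  (∃ t', P.classHome t q = some t' ∧ m' = { m with decl := t' }) ∨
  (P.classHome t q = none ∧ P.DefaultFor t m m' ∧
    ∀ m'', P.DefaultFor t m m'' → P.Sub m''.decl m'.decl → m''.decl = m'.decl)

end Program

/-! ## Execution -/

/-- Values.  `Class`, `Method` and `Field` objects are immutable and are represented by what they
stand for; all other objects live on the heap. -/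
inductive Val where
  | null
  | ref (a : ℕ)
  | cls (t : ClassName)
  | mtd (m : Method)
  | fld (f : Field)

/-- A heap object, with the site at which it was allocated. -/
structure Obj where
  site : Site
  cls : ClassName
  /-- the characters of a string -/
  str : Option Str
  fields : Field → Val
  /-- the elements of an array -/
  elems : Option (List Val)

abbrev Heap := ℕ → Option Obj

abbrev Env := Local → Val

structure Frame where
  scope : Scope
  pc : ℕ
  env : Env

structure State where
  heap : Heap
  stack : List Frame

/-- The dynamic type of a value. -/
def typeOf (h : Heap) : Val → Option ClassName
  | .null => none
  | .ref a => (h a).map Obj.cls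
  | .cls _ => some .javaLangClass
  | .mtd _ => some .javaLangReflectMethod
  | .fld _ => some .javaLangReflectField

/-- `v` is null or an instance of `A`. -/
def Fits (P : Program) (h : Heap) (A : ClassName) (v : Val) : Prop :=
  v = .null ∨ ∃ t, typeOf h v = some t ∧ P.Sub t A

/-- `v` is a string object with value `s`. -/
def IsStr (h : Heap) (v : Val) (s : Str) : Prop :=
  ∃ a o, v = .ref a ∧ h a = some o ∧ o.str = some s

/-- `vs` are the arguments that `invoke` reads from its argument array (which may be null). -/
def IsArgs (h : Heap) (v : Val) (vs : List Val) : Prop :=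
  (v = .null ∧ vs = []) ∨ ∃ a o, v = .ref a ∧ h a = some o ∧ o.elems = some vs

/-- A possible string value of a fresh instance of the class `t`. -/
def FreshStr (t : ClassName) (s : Option Str) : Prop :=
  s.isSome ↔ t = .javaLangString

/-- What a step does, as far as calls and reflection are concerned. -/
inductive Event where
  | silent
  /-- an ordinary call, entering `callee` -/
  | call (i : Site) (callee : Method)
  /-- `newInstance()` creates an instance of `t` -/
  | newInstance (i : Site) (t : ClassName)
  /-- `invoke()` on a `Method` object for `target`, entering `callee` -/
  | invoke (i : Site) (target callee : Method)
  /-- `get()` on a `Field` object for `f` -/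
  | get (i : Site) (f : Field)
  /-- `set()` on a `Field` object for `f` -/
  | set (i : Site) (f : Field)

open Function (update)

/-- Execution of one statement at site `i` that does not enter a method.  Statements that throw an
exception (among them a failing cast) have no transition. -/
inductive Eval (P : Program) (i : Site) (h : Heap) (e : Env) : Stmt → Event → Heap → Env → Prop
  | new {x t a s cd} (hcd : P.find t = some cd) (hinst : cd.isAbstract = false)
      (ha : h a = none) (hs : FreshStr t s) :
      Eval P i h e (.new x t) .silent
        (update h a (some ⟨i, t, s, fun _ => .null, none⟩)) (update e x (.ref a))
  | copy {x y} : Eval P i h e (.copy x y) .silent h (update e x (e y))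
  | load {x y f a o} (hy : e y = .ref a) (ho : h a = some o)
      (hsub : P.Sub o.cls f.decl) (hf : P.DeclaresField f) :
      Eval P i h e (.load x y f) .silent h (update e x (o.fields f))
  | store {x y f a o} (hx : e x = .ref a) (ho : h a = some o)
      (hsub : P.Sub o.cls f.decl) (hf : P.DeclaresField f) :
      Eval P i h e (.store x f y) .silent
        (update h a (some { o with fields := update o.fields f (e y) })) e
  | lit {x v a} (ha : h a = none) :
      Eval P i h e (.lit x v) .silent
        (update h a (some ⟨i, .javaLangString, some v, fun _ => .null, none⟩)) (update e x (.ref a))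
  | newArr {x t a} (n : ℕ) (ha : h a = none) :
      Eval P i h e (.newArr x t) .silent
        (update h a (some ⟨i, t, none, fun _ => .null, some (List.replicate n .null)⟩))
        (update e x (.ref a))
  | aload {x y a o vs v} (hy : e y = .ref a) (ho : h a = some o) (hvs : o.elems = some vs)
      (hv : v ∈ vs) :
      Eval P i h e (.aload x y) .silent h (update e x v)
  | astore {x y a o vs k} (hx : e x = .ref a) (ho : h a = some o) (hvs : o.elems = some vs)
      (hk : k < vs.length) :
      Eval P i h e (.astore x y) .silent
        (update h a (some { o with elems := some (vs.set k (e y)) })) e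
  | cast {x A y} (hA : Fits P h A (e y)) :
      Eval P i h e (.cast x A y) .silent h (update e x (e y))
  | forName {c cName t cd} (hs : IsStr h (e cName) t) (ht : P.find t = some cd) :
      Eval P i h e (.forName c cName) .silent h (update e c (.cls t))
  | getMethod {m c mName ps t n ts m'} (hc : e c = .cls t) (hs : IsStr h (e mName) n)
      (hps : ps.map e = ts.map Val.cls) (hm : P.GetMethod t n ts m') :
      Eval P i h e (.getMethod m c mName ps) .silent h (update e m (.mtd m'))
  | getField {f c fName t n f'} (hc : e c = .cls t) (hs : IsStr h (e fName) n)
      (hf : P.GetField t n f') :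
      Eval P i h e (.getField f c fName) .silent h (update e f (.fld f'))
  | newInstance {o c t a s cd} (hc : e c = .cls t) (hcd : P.find t = some cd)
      (hinst : cd.isAbstract = false) (ha : h a = none) (hs : FreshStr t s) :
      Eval P i h e (.newInstance o c) (.newInstance i t)
        (update h a (some ⟨i, t, s, fun _ => .null, none⟩)) (update e o (.ref a))
  | get {x A f y f' a o} (hf : e f = .fld f') (hy : e y = .ref a) (ho : h a = some o)
      (hsub : P.Sub o.cls f'.decl) (hA : Fits P h A (o.fields f')) :
      Eval P i h e (.get x A f y) (.get i f') h (update e x (o.fields f'))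
  | set {f y x f' a o} (hf : e f = .fld f') (hy : e y = .ref a) (ho : h a = some o)
      (hsub : P.Sub o.cls f'.decl) (hx : Fits P h f'.type (e x)) :
      Eval P i h e (.set f y x) (.set i f')
        (update h a (some { o with fields := update o.fields f' (e x) })) e

/-- The environment at the entry of a method. -/
def entryEnv (recv : Val) (vs : List Val) : Env
  | .this => recv
  | .param k => vs[k]?.getD .null
  | _ => .null

/-- The value `v` is returned to the variable `x` by a call statement. -/
inductive Returns (P : Program) (h : Heap) (v : Val) : Stmt → Local → Prop
  | call {x y m args} : Returns P h v (.call x y m args) x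
  | invoke {x A m y args} (hA : Fits P h A v) : Returns P h v (.invoke x A m y args) x

inductive Step (P : Program) : State → Event → State → Prop
  | eval {h fr fs s nxt ev h' e' pc'} (hi : P.instrAt (fr.scope, fr.pc) = some ⟨s, nxt⟩)
      (he : Eval P (fr.scope, fr.pc) h fr.env s ev h' e') (hpc : pc' ∈ nxt) :
      Step P ⟨h, fr :: fs⟩ ev ⟨h', ⟨fr.scope, pc', e'⟩ :: fs⟩
  | call {h fr fs x y m args nxt t m'}
      (hi : P.instrAt (fr.scope, fr.pc) = some ⟨.call x y m args, nxt⟩)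
      (ht : typeOf h (fr.env y) = some t) (hd : P.Dispatch t m m')
      (hb : (P.body (.meth m')).isSome) :
      Step P ⟨h, fr :: fs⟩ (.call (fr.scope, fr.pc) m')
        ⟨h, ⟨.meth m', 0, entryEnv (fr.env y) (args.map fr.env)⟩ :: fr :: fs⟩
  | invoke {h fr fs x A m y args nxt t m' m'' vs}
      (hi : P.instrAt (fr.scope, fr.pc) = some ⟨.invoke x A m y args, nxt⟩)
      (hm : fr.env m = .mtd m') (ht : typeOf h (fr.env y) = some t) (hsub : P.Sub t m'.decl)
      (hargs : IsArgs h (fr.env args) vs)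
      (hfit : List.Forall₂ (Fits P h) m'.params vs)
      (hd : P.Dispatch t m' m'') (hb : (P.body (.meth m'')).isSome) :
      Step P ⟨h, fr :: fs⟩ (.invoke (fr.scope, fr.pc) m' m'')
        ⟨h, ⟨.meth m'', 0, entryEnv (fr.env y) vs⟩ :: fr :: fs⟩
  | ret {h fr gr fs s nxt x pc'} (hend : P.instrAt (fr.scope, fr.pc) = none)
      (hi : P.instrAt (gr.scope, gr.pc) = some ⟨s, nxt⟩)
      (hr : Returns P h (fr.env .ret) s x) (hpc : pc' ∈ nxt) :
      Step P ⟨h, fr :: gr :: fs⟩ .silent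
        ⟨h, ⟨gr.scope, pc', update gr.env x (fr.env .ret)⟩ :: fs⟩

def initState : State := ⟨fun _ => none, [⟨.main, 0, fun _ => .null⟩]⟩

def Reachable (P : Program) (st : State) : Prop :=
  Relation.ReflTransGen (fun s s' => ∃ ev, Step P s ev s') initState st

end RefJava

/-! ## The analysis -/

namespace Solar

open RefJava

/-- A method signature; `none` is the unknown `u`. -/
structure MSig where
  ret : Option ClassName
  name : Option Str
  params : Option (List ClassName)

/-- A field signature; `none` is the unknown `u`. -/
structure FSig where
  type : Option ClassName
  name : Option Str

/-- `s'` agrees with `s` wherever `s` is known. -/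
def MSig.Refines (s' s : MSig) : Prop :=
  (s.ret ≠ none → s'.ret = s.ret) ∧ (s.name ≠ none → s'.name = s.name) ∧
    (s.params ≠ none → s'.params = s.params)

def FSig.Refines (s' s : FSig) : Prop :=
  (s.type ≠ none → s'.type = s.type) ∧ (s.name ≠ none → s'.name = s.name)

/-- Abstract objects `o_i^t`, `c^t`, `m^t_s`, `f^t_s`; the class `none` is the unknown `u`. -/
inductive AbsObj where
  | obj (i : Site) (t : Option ClassName)
  | cls (t : Option ClassName)
  | mtd (t : Option ClassName) (s : MSig)
  | fld (t : Option ClassName) (s : FSig)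

/-- The class of an abstract object, if known. -/
def AbsObj.type : AbsObj → Option ClassName
  | .obj _ t => t
  | .cls _ => some .javaLangClass
  | .mtd _ _ => some .javaLangReflectMethod
  | .fld _ _ => some .javaLangReflectField

/-- Pointers: local variables, fields and (collapsed) elements of abstract objects, and the
arguments created for the target `m` of a reflective call at site `i`. -/
inductive Node where
  | var (σ : Scope) (x : Local)
  | field (o : AbsObj) (f : Field)
  | arr (o : AbsObj)
  | arg (i : Site) (m : Method) (k : ℕ)

/-- Regular statements generated by the transformation of reflective calls.  The ordinary calls,
loads and stores of the program are presented to the pointer analysis in the same form. -/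
inductive Reg where
  | load (x y : Node) (f : Field)
  | store (x : Node) (f : Field) (y : Node)
  | call (i : Site) (x y : Node) (m : Method) (args : List Node)

/-- The facts computed by the analysis: `a ∈ pt(n)`, a regular statement, and `ps ∈ Ptp(args)` for
the `invoke` call at `i`. -/
inductive Fact where
  | pt (n : Node) (a : AbsObj)
  | stmt (r : Reg)
  | ptp (i : Site) (ps : List ClassName)

variable (P : Program)

/-- The value of the string constant created at a site; it is `none` unless the string object of
that site is a string constant. -/
def litAt (i : Site) : Option Str :=
  match P.stmtAt i with
  | some (.lit _ v) => some v
  | _ => none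

/-- The methods declared in `t` that match `s`, unknown parts being wild cards. -/
def mtdLookUp (t : ClassName) (s : MSig) : Set Method :=
  {m | m.decl = t ∧ P.DeclaresMethod m ∧ (∀ r, s.ret = some r → m.ret = r) ∧
    (∀ n, s.name = some n → m.name = n) ∧ ∀ ps, s.params = some ps → m.params = ps}

/-- The fields declared in `t` that match `s`, unknown parts being wild cards. -/
def fldLookUp (t : ClassName) (s : FSig) : Set Field :=
  {f | f.decl = t ∧ P.DeclaresField f ∧ (∀ r, s.type = some r → f.type = r) ∧
    ∀ n, s.name = some n → f.name = n}

/-- Target search for `m^t_s`. -/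
def MTD (t : ClassName) (s : MSig) : Set Method :=
  ⋃ t' ∈ {t' | P.Sub t t'}, mtdLookUp P t' s

/-- Target search for `f^t_s`. -/
def FLD (t : ClassName) (s : FSig) : Set Field :=
  ⋃ t' ∈ {t' | P.Sub t t'}, fldLookUp P t' s

/-- The classes in which a method with signature `s` is defined (declared or inherited). -/
def classesOfMethod (s : MSig) : Set ClassName :=
  {t | s.name ≠ none ∧ s.params ≠ none ∧ (MTD P t s).Nonempty}

/-- The classes in which a field with signature `s` is defined (declared or inherited). -/
def classesOfField (s : FSig) : Set ClassName :=
  {t | s.name ≠ none ∧ s.type ≠ none ∧ (FLD P t s).Nonempty}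

/-- The facts derived by the analysis.  The parameter `ex` is the result of an intra-procedural
analysis: if it can determine the elements of the argument array of the `invoke` call at `i`, then
`ex i` is the list of the variables that hold them.  The rules of lazy heap modeling that deal with
objects of unknown type are switched on by `lhm`. -/
inductive Derives (ex : Site → Option (List Local)) (lhm : Bool) : Fact → Prop
  -- pointer analysis
  | aNew {σ pc x t} (hs : P.stmtAt (σ, pc) = some (.new x t)) :
      Derives ex lhm (.pt (.var σ x) (.obj (σ, pc) (some t)))
  | aLit {σ pc x v} (hs : P.stmtAt (σ, pc) = some (.lit x v)) :
      Derives ex lhm (.pt (.var σ x) (.obj (σ, pc) (some .javaLangString)))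
  | aNewArr {σ pc x t} (hs : P.stmtAt (σ, pc) = some (.newArr x t)) :
      Derives ex lhm (.pt (.var σ x) (.obj (σ, pc) (some t)))
  | aCpy {σ pc x y a} (hs : P.stmtAt (σ, pc) = some (.copy x y))
      (hy : Derives ex lhm (.pt (.var σ y) a)) :
      Derives ex lhm (.pt (.var σ x) a)
  -- a cast copies everything, but to a type other than `Object` no object of unknown type
  | aCast {σ pc x A y a} (hs : P.stmtAt (σ, pc) = some (.cast x A y))
      (hy : Derives ex lhm (.pt (.var σ y) a))
      (ha : A = .javaLangObject ∨ ∀ i, a ≠ .obj i none) :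
      Derives ex lhm (.pt (.var σ x) a)
  | aALd {σ pc x y i t a} (hs : P.stmtAt (σ, pc) = some (.aload x y))
      (hy : Derives ex lhm (.pt (.var σ y) (.obj i (some t))))
      (ha : Derives ex lhm (.pt (.arr (.obj i (some t))) a)) :
      Derives ex lhm (.pt (.var σ x) a)
  | aASt {σ pc x y i t a} (hs : P.stmtAt (σ, pc) = some (.astore x y))
      (hx : Derives ex lhm (.pt (.var σ x) (.obj i (some t))))
      (hy : Derives ex lhm (.pt (.var σ y) a)) :
      Derives ex lhm (.pt (.arr (.obj i (some t))) a)
  | sLoad {σ pc x y f} (hs : P.stmtAt (σ, pc) = some (.load x y f)) :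
      Derives ex lhm (.stmt (.load (.var σ x) (.var σ y) f))
  | sStore {σ pc x f y} (hs : P.stmtAt (σ, pc) = some (.store x f y)) :
      Derives ex lhm (.stmt (.store (.var σ x) f (.var σ y)))
  | sCall {σ pc x y m args} (hs : P.stmtAt (σ, pc) = some (.call x y m args)) :
      Derives ex lhm (.stmt (.call (σ, pc) (.var σ x) (.var σ y) m (args.map (Node.var σ))))
  | aLd {x y f i t a} (hs : Derives ex lhm (.stmt (.load x y f)))
      (hy : Derives ex lhm (.pt y (.obj i (some t))))
      (ha : Derives ex lhm (.pt (.field (.obj i (some t)) f) a)) :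
      Derives ex lhm (.pt x a)
  | aSt {x f y i t a} (hs : Derives ex lhm (.stmt (.store x f y)))
      (hx : Derives ex lhm (.pt x (.obj i (some t))))
      (hy : Derives ex lhm (.pt y a)) :
      Derives ex lhm (.pt (.field (.obj i (some t)) f) a)
  | aCallThis {i x y m args o t m'} (hs : Derives ex lhm (.stmt (.call i x y m args)))
      (hy : Derives ex lhm (.pt y o)) (ht : o.type = some t) (hd : P.Dispatch t m m') :
      Derives ex lhm (.pt (.var (.meth m') .this) o)
  | aCallRet {i x y m args o t m' a} (hs : Derives ex lhm (.stmt (.call i x y m args)))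
      (hy : Derives ex lhm (.pt y o)) (ht : o.type = some t) (hd : P.Dispatch t m m')
      (ha : Derives ex lhm (.pt (.var (.meth m') .ret) a)) :
      Derives ex lhm (.pt x a)
  | aCallArg {i x y m args o t m' k n a} (hs : Derives ex lhm (.stmt (.call i x y m args)))
      (hy : Derives ex lhm (.pt y o)) (ht : o.type = some t) (hd : P.Dispatch t m m')
      (hk : args[k]? = some n) (ha : Derives ex lhm (.pt n a)) :
      Derives ex lhm (.pt (.var (.meth m') (.param k)) a)
  -- the two methods that can be called on an object of unknown type
  | aCallToString {i x y m args j} (hs : Derives ex lhm (.stmt (.call i x y m args)))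
      (hy : Derives ex lhm (.pt y (.obj j none))) (hm : m.name = .toStringName ∧ m.params = []) :
      Derives ex lhm (.pt x (.obj i (some .javaLangString)))
  | aCallGetClass {i x y m args j} (hs : Derives ex lhm (.stmt (.call i x y m args)))
      (hy : Derives ex lhm (.pt y (.obj j none))) (hm : m.name = .getClassName ∧ m.params = []) :
      Derives ex lhm (.pt x (.cls none))
  -- propagation
  | pForNameConst {σ pc c x j t cd} (hs : P.stmtAt (σ, pc) = some (.forName c x))
      (hx : Derives ex lhm (.pt (.var σ x) (.obj j (some .javaLangString))))
      (hl : litAt P j = some t) (ht : P.find t = some cd) :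
      Derives ex lhm (.pt (.var σ c) (.cls (some t)))
  | pForNameUnk {σ pc c x j} (hs : P.stmtAt (σ, pc) = some (.forName c x))
      (hx : Derives ex lhm (.pt (.var σ x) (.obj j (some .javaLangString))))
      (hl : litAt P j = none) :
      Derives ex lhm (.pt (.var σ c) (.cls none))
  | pGetMtd {σ pc m c x ps j t} (hs : P.stmtAt (σ, pc) = some (.getMethod m c x ps))
      (hx : Derives ex lhm (.pt (.var σ x) (.obj j (some .javaLangString))))
      (hc : Derives ex lhm (.pt (.var σ c) (.cls t))) :
      Derives ex lhm (.pt (.var σ m) (.mtd t ⟨none, litAt P j, none⟩))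
  | pGetFld {σ pc f c x j t} (hs : P.stmtAt (σ, pc) = some (.getField f c x))
      (hx : Derives ex lhm (.pt (.var σ x) (.obj j (some .javaLangString))))
      (hc : Derives ex lhm (.pt (.var σ c) (.cls t))) :
      Derives ex lhm (.pt (.var σ f) (.fld t ⟨none, litAt P j⟩))
  -- collective inference: argument types
  | iPtp {σ pc x A m y args ys ps} {a : ℕ → AbsObj}
      (hs : P.stmtAt (σ, pc) = some (.invoke x A m y args))
      (hex : ex (σ, pc) = some ys) (hlen : ys.length = ps.length)
      (ha : ∀ k z, ys[k]? = some z → Derives ex lhm (.pt (.var σ z) (a k)))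
      (ht : ∀ k t', ps[k]? = some t' → ∃ t, (a k).type = some t ∧ P.Sub t t') :
      Derives ex lhm (.ptp (σ, pc) ps)
  -- collective inference: invoke
  | iInvTp {σ pc x A m y args s o t} (hs : P.stmtAt (σ, pc) = some (.invoke x A m y args))
      (hm : Derives ex lhm (.pt (.var σ m) (.mtd none s)))
      (hy : Derives ex lhm (.pt (.var σ y) o)) (ht : o.type = some t) :
      Derives ex lhm (.pt (.var σ m) (.mtd (some t) s))
  | iInvSig {σ pc x A m y args t r r' ps}
      (hs : P.stmtAt (σ, pc) = some (.invoke x A m y args))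
      (hm : Derives ex lhm (.pt (.var σ m) (.mtd t ⟨r, none, none⟩)))
      (hp : Derives ex lhm (.ptp (σ, pc) ps)) (hr : P.CastRel r' A) :
      Derives ex lhm (.pt (.var σ m) (.mtd t ⟨r', none, some ps⟩))
  | iInvS2T {σ pc x A m y args s s' j t ps}
      (hs : P.stmtAt (σ, pc) = some (.invoke x A m y args))
      (hm : Derives ex lhm (.pt (.var σ m) (.mtd none s)))
      (hy : Derives ex lhm (.pt (.var σ y) (.obj j none)))
      (href : s'.Refines s) (hr : P.CastRel s'.ret A) (hn : s.name ≠ none)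
      (hp : Derives ex lhm (.ptp (σ, pc) ps)) (hps : s'.params = some ps)
      (ht : t ∈ classesOfMethod P s') :
      Derives ex lhm (.pt (.var σ m) (.mtd (some t) s'))
  -- collective inference: get
  | iGetTp {σ pc x A f y s o t} (hs : P.stmtAt (σ, pc) = some (.get x A f y))
      (hf : Derives ex lhm (.pt (.var σ f) (.fld none s)))
      (hy : Derives ex lhm (.pt (.var σ y) o)) (ht : o.type = some t) :
      Derives ex lhm (.pt (.var σ f) (.fld (some t) s))
  | iGetSig {σ pc x A f y t r} (hs : P.stmtAt (σ, pc) = some (.get x A f y))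
      (hf : Derives ex lhm (.pt (.var σ f) (.fld t ⟨none, none⟩))) (hr : P.CastRel r A) :
      Derives ex lhm (.pt (.var σ f) (.fld t ⟨r, none⟩))
  | iGetS2T {σ pc x A f y s s' j t} (hs : P.stmtAt (σ, pc) = some (.get x A f y))
      (hf : Derives ex lhm (.pt (.var σ f) (.fld none s)))
      (hy : Derives ex lhm (.pt (.var σ y) (.obj j none)))
      (href : s'.Refines s) (hn : s.name ≠ none) (hr : P.CastRel s'.type A)
      (ht : t ∈ classesOfField P s') :
      Derives ex lhm (.pt (.var σ f) (.fld (some t) s'))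
  -- collective inference: set
  | iSetTp {σ pc f y x s o t} (hs : P.stmtAt (σ, pc) = some (.set f y x))
      (hf : Derives ex lhm (.pt (.var σ f) (.fld none s)))
      (hy : Derives ex lhm (.pt (.var σ y) o)) (ht : o.type = some t) :
      Derives ex lhm (.pt (.var σ f) (.fld (some t) s))
  | iSetSig {σ pc f y x t o t₁ t₂} (hs : P.stmtAt (σ, pc) = some (.set f y x))
      (hf : Derives ex lhm (.pt (.var σ f) (.fld t ⟨none, none⟩)))
      (hx : Derives ex lhm (.pt (.var σ x) o)) (ho : o.type = some t₁) (hsub : P.Sub t₁ t₂) :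
      Derives ex lhm (.pt (.var σ f) (.fld t ⟨some t₂, none⟩))
  | iSetS2T {σ pc f y x s s' j t o t₁ t₂} (hs : P.stmtAt (σ, pc) = some (.set f y x))
      (hf : Derives ex lhm (.pt (.var σ f) (.fld none s)))
      (hy : Derives ex lhm (.pt (.var σ y) (.obj j none)))
      (href : s'.Refines s) (hn : s.name ≠ none)
      (hx : Derives ex lhm (.pt (.var σ x) o)) (ho : o.type = some t₁) (hsub : P.Sub t₁ t₂)
      (hty : s'.type = some t₂) (ht : t ∈ classesOfField P s') :
      Derives ex lhm (.pt (.var σ f) (.fld (some t) s'))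
  -- transformation
  | tInvCall {σ pc x A m y args t s m'} (hs : P.stmtAt (σ, pc) = some (.invoke x A m y args))
      (hm : Derives ex lhm (.pt (.var σ m) (.mtd (some t) s))) (ht : m' ∈ MTD P t s) :
      Derives ex lhm (.stmt (.call (σ, pc) (.var σ x) (.var σ y) m'
        ((List.range m'.params.length).map (Node.arg (σ, pc) m'))))
  | tInvArg {σ pc x A m y args t s m' o a k t' t''}
      (hs : P.stmtAt (σ, pc) = some (.invoke x A m y args))
      (hm : Derives ex lhm (.pt (.var σ m) (.mtd (some t) s))) (ht : m' ∈ MTD P t s)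
      (ho : Derives ex lhm (.pt (.var σ args) o)) (ha : Derives ex lhm (.pt (.arr o) a))
      (hk : m'.params[k]? = some t'') (hty : a.type = some t') (hsub : P.Sub t' t'') :
      Derives ex lhm (.pt (.arg (σ, pc) m' k) a)
  | tGet {σ pc x A f y t s f'} (hs : P.stmtAt (σ, pc) = some (.get x A f y))
      (hf : Derives ex lhm (.pt (.var σ f) (.fld (some t) s))) (ht : f' ∈ FLD P t s) :
      Derives ex lhm (.stmt (.load (.var σ x) (.var σ y) f'))
  | tSet {σ pc f y x t s f'} (hs : P.stmtAt (σ, pc) = some (.set f y x))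
      (hf : Derives ex lhm (.pt (.var σ f) (.fld (some t) s))) (ht : f' ∈ FLD P t s) :
      Derives ex lhm (.stmt (.store (.var σ y) f' (.var σ x)))
  -- heap modeling
  | lKwTp {σ pc o c t} (hs : P.stmtAt (σ, pc) = some (.newInstance o c))
      (hc : Derives ex lhm (.pt (.var σ c) (.cls (some t)))) :
      Derives ex lhm (.pt (.var σ o) (.obj (σ, pc) (some t)))
  | lUkwTp {σ pc o c} (hl : lhm = true) (hs : P.stmtAt (σ, pc) = some (.newInstance o c))
      (hc : Derives ex lhm (.pt (.var σ c) (.cls none))) :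
      Derives ex lhm (.pt (.var σ o) (.obj (σ, pc) none))
  | lCast {σ pc x A y i t} (hl : lhm = true) (hs : P.stmtAt (σ, pc) = some (.cast x A y))
      (hA : A ≠ .javaLangObject) (hy : Derives ex lhm (.pt (.var σ y) (.obj i none)))
      (ht : P.Sub t A) :
      Derives ex lhm (.pt (.var σ x) (.obj i (some t)))
  | lInv {σ pc x A m y args i t s t'} (hl : lhm = true)
      (hs : P.stmtAt (σ, pc) = some (.invoke x A m y args))
      (hy : Derives ex lhm (.pt (.var σ y) (.obj i none)))
      (hm : Derives ex lhm (.pt (.var σ m) (.mtd (some t) s))) (ht : P.CastRel (some t') t) :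
      Derives ex lhm (.pt (.var σ y) (.obj i (some t')))
  | lGet {σ pc x A f y i t s t'} (hl : lhm = true)
      (hs : P.stmtAt (σ, pc) = some (.get x A f y))
      (hy : Derives ex lhm (.pt (.var σ y) (.obj i none)))
      (hf : Derives ex lhm (.pt (.var σ f) (.fld (some t) s))) (ht : P.CastRel (some t') t) :
      Derives ex lhm (.pt (.var σ y) (.obj i (some t')))
  | lSet {σ pc f y x i t s t'} (hl : lhm = true)
      (hs : P.stmtAt (σ, pc) = some (.set f y x))
      (hy : Derives ex lhm (.pt (.var σ y) (.obj i none)))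
      (hf : Derives ex lhm (.pt (.var σ f) (.fld (some t) s))) (ht : P.CastRel (some t') t) :
      Derives ex lhm (.pt (.var σ y) (.obj i (some t')))

/-- The points-to sets computed by the full analysis. -/
def pt (ex : Site → Option (List Local)) (n : Node) : Set AbsObj :=
  {a | Derives P ex true (.pt n a)}

/-- The call graph: `callee` may be entered from the (ordinary or reflective) call at `i`. -/
def CallEdge (ex : Site → Option (List Local)) (i : Site) (callee : Method) : Prop :=
  ∃ x y m args, Derives P ex true (.stmt (.call i x y m args)) ∧
    ∃ o ∈ pt P ex y, ∃ t, o.type = some t ∧ P.Dispatch t m callee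

/-- The target methods found by target search at the `invoke` call at `i`. -/
def methodTargets (ex : Site → Option (List Local)) (i : Site) : Set Method :=
  {m' | ∃ x A m y args, P.stmtAt i = some (.invoke x A m y args) ∧
    ∃ t s, AbsObj.mtd (some t) s ∈ pt P ex (.var i.1 m) ∧ m' ∈ MTD P t s}

/-- The target fields found by target search at the `get` or `set` call at `i`. -/
def fieldTargets (ex : Site → Option (List Local)) (i : Site) : Set Field :=
  {f' | ∃ f y, ((∃ x A, P.stmtAt i = some (.get x A f y)) ∨ ∃ x, P.stmtAt i = some (.set f y x)) ∧
    ∃ t s, AbsObj.fld (some t) s ∈ pt P ex (.var i.1 f) ∧ f' ∈ FLD P t s}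

/-- The classes of which the `newInstance` call at `i` is found to create instances. -/
def classTargets (ex : Site → Option (List Local)) (i : Site) : Set ClassName :=
  {t | ∃ o c, P.stmtAt i = some (.newInstance o c) ∧ AbsObj.cls (some t) ∈ pt P ex (.var i.1 c)}

/-- The abstract objects in `S` cover the value `v`. -/
def Covers (h : Heap) (v : Val) (S : Set AbsObj) : Prop :=
  match v with
  | .null => True
  | .ref a => ∃ o, h a = some o ∧ AbsObj.obj o.site (some o.cls) ∈ S
  | .cls t => AbsObj.cls (some t) ∈ S
  | .mtd m => ∃ t s, AbsObj.mtd (some t) s ∈ S ∧ m ∈ MTD P t s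
  | .fld f => ∃ t s, AbsObj.fld (some t) s ∈ S ∧ f ∈ FLD P t s

/-- Soundness: in every reachable state, the points-to sets cover the values of all variables,
fields and array elements, and the calls and reflective targets of every step are found. -/
structure Sound (ex : Site → Option (List Local)) : Prop where
  vars : ∀ st, Reachable P st → ∀ fr ∈ st.stack, ∀ x,
    Covers P st.heap (fr.env x) (pt P ex (.var fr.scope x))
  fields : ∀ st, Reachable P st → ∀ a o, st.heap a = some o → ∀ f,
    Covers P st.heap (o.fields f) (pt P ex (.field (.obj o.site (some o.cls)) f))
  elems : ∀ st, Reachable P st → ∀ a o, st.heap a = some o → ∀ vs, o.elems = some vs →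
    ∀ v ∈ vs, Covers P st.heap v (pt P ex (.arr (.obj o.site (some o.cls))))
  calls : ∀ st i m st', Reachable P st → Step P st (.call i m) st' → CallEdge P ex i m
  newInstances : ∀ st i t st', Reachable P st → Step P st (.newInstance i t) st' →
    t ∈ classTargets P ex i
  invokes : ∀ st i m m' st', Reachable P st → Step P st (.invoke i m m') st' →
    m ∈ methodTargets P ex i ∧ CallEdge P ex i m'
  gets : ∀ st i f st', Reachable P st → Step P st (.get i f) st' → f ∈ fieldTargets P ex i
  sets : ∀ st i f st', Reachable P st → Step P st (.set i f) st' → f ∈ fieldTargets P ex i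

/-- The variable `x` of `σ` is assigned string constants only, possibly through copies (of other
such variables). -/
def IsLiteralVar (σ : Scope) (x : Local) : Prop :=
  ∃ K : Set Local, x ∈ K ∧ Local.this ∉ K ∧ (∀ k, Local.param k ∉ K) ∧
    ∀ pc s z, P.stmtAt (σ, pc) = some s → s.def? = some z → z ∈ K →
      (∃ v, s = .lit z v) ∨ ∃ y ∈ K, s = .copy z y

/-- The programs in which `cName` is a string constant in every call `Class.forName(cName)`:
either it is assigned string constants only, or, more generally, every string object that the
analysis finds it to point to is a string constant (which may come from elsewhere). -/
def RefJavaC (ex : Site → Option (List Local)) : Prop :=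
  ∀ σ pc c cName, P.stmtAt (σ, pc) = some (.forName c cName) →
    IsLiteralVar P σ cName ∨
      ∀ j, AbsObj.obj j (some .javaLangString) ∈ pt P ex (.var σ cName) → litAt P j ≠ none

/-- The abstract object has an unknown class or belongs to an unknown class. -/
def AbsObj.Unknown : AbsObj → Prop
  | .obj _ t => t = none
  | .cls t => t = none
  | .mtd t _ => t = none
  | .fld t _ => t = none

end Solar

/-! ### Member search and growth of the heap. -/

namespace RefJava

/-! Unknown classes have a single source. Among the rules that conclude with an object of unknown
class, only `pForNameUnk` does so without having such an object among its premises, and it needs a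
non-constant string at a `forName` call. `RefJavaC` excludes this, so induction on derivations shows
that every points-to fact has a known class (`Derives.known`). The syntactic form of the hypothesis
forces a stronger induction statement: variables assigned only constants must be shown to point only
to constants, hence no other rule, and no statement generated from a reflective call, may write to
them.

The claims on lazy heap modeling and `newInstance` then follow. Each guarded rule consumes an object
of unknown type and so never fires (`Derives.lhm_iff`). Tracing an object of a `newInstance` site
back through the rules that merely move it leads to `lKwTp` (`Derives.cls_of_newInstance`).

Soundness is a forward simulation: `SoundState` holds initially and is preserved by every step
(`SoundState.step`). At a `forName` call the covering string must be a constant, and a constant has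
the same value at run time, so the abstract class is the right one. Classes being known, the Method
and Field objects produced by propagation already have the run-time member among their targets, with
the unknown parts of the signature as wild cards. The simulation therefore never invokes collective
inference, which is why the parameter `ex` may be arbitrary. -/

theorem Program.sub_of_search {P : Program} {supers : ClassDecl → List ClassName}
    (hs : ∀ cd, ∀ t ∈ supers cd, cd.super = some t ∨ t ∈ cd.interfaces) {q : ClassDecl → Bool} :
    ∀ {n : ℕ} {t t' : ClassName}, P.search supers q n t = some t' → P.Sub t t'
  | 0, _, _, h => by simp [Program.search] at h
  | n + 1, t, t', h => by
    unfold Program.search at h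
    split at h
    · simp at h
    · rename_i cd hcd
      split at h
      · obtain rfl : t = t' := by simpa using h
        exact .refl
      · obtain ⟨u, hu, hut⟩ := List.exists_of_findSome?_eq_some h
        exact .head ⟨cd, hcd, hs cd u hu⟩ (sub_of_search hs hut)

theorem Program.sub_of_methodHome {P : Program} {t t' : ClassName} {q : ClassDecl → Bool}
    (h : P.methodHome t q = some t') : P.Sub t t' :=
  Program.sub_of_search (by simp) h

theorem Program.sub_of_fieldHome {P : Program} {t t' : ClassName} {q : ClassDecl → Bool}
    (h : P.fieldHome t q = some t') : P.Sub t t' :=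
  Program.sub_of_search (by simp [or_comm]) h

theorem Program.stmtAt_of_instrAt {P : Program} {i : Site} {s : Stmt} {nxt : List ℕ}
    (h : P.instrAt i = some ⟨s, nxt⟩) : P.stmtAt i = some s := by
  simp [Program.stmtAt, h]

theorem Returns.def? {P : Program} {h : Heap} {v : Val} {s : Stmt} {x : Local}
    (hr : Returns P h v s x) : s.def? = some x := by
  cases hr <;> rfl

/-- The objects of `h` are still there in `h'`, with the same sites and classes. -/
def Heap.Extends (h h' : Heap) : Prop :=
  ∀ a o, h a = some o → ∃ o', h' a = some o' ∧ o'.site = o.site ∧ o'.cls = o.cls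

theorem Heap.Extends.refl (h : Heap) : h.Extends h := fun _ o ho => ⟨o, ho, rfl, rfl⟩

theorem Heap.extends_alloc {h : Heap} {a : ℕ} (ha : h a = none) (o : Obj) :
    h.Extends (Function.update h a (some o)) := by
  intro b p hb
  have hne : b ≠ a := by
    rintro rfl
    simp [ha] at hb
  exact ⟨p, by simpa [hne] using hb, rfl, rfl⟩

theorem Heap.extends_update {h : Heap} {a : ℕ} {o o' : Obj} (ha : h a = some o)
    (hs : o'.site = o.site) (hc : o'.cls = o.cls) :
    h.Extends (Function.update h a (some o')) := by
  intro b p hb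
  by_cases hne : b = a
  · subst hne
    obtain rfl : o = p := by simpa [ha] using hb
    exact ⟨o', by simp, hs, hc⟩
  · exact ⟨p, by simpa [hne] using hb, rfl, rfl⟩

end RefJava

namespace Solar

open RefJava

variable {P : Program} {ex : Site → Option (List Local)}

/-! ### Literal variables and the absence of unknown classes. -/

/-- The witnessing set `K` is closed under the sources of copies, so the same `K` serves for the
variable copied from. -/
theorem IsLiteralVar.of_def {σ : Scope} {x : Local} (h : IsLiteralVar P σ x) {pc : ℕ} {s : Stmt}
    (hs : P.stmtAt (σ, pc) = some s) (hd : s.def? = some x) :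
    (∃ v, s = .lit x v) ∨ ∃ y, IsLiteralVar P σ y ∧ s = .copy x y := by
  obtain ⟨K, hx, ht, hp, hK⟩ := h
  rcases hK pc s x hs hd hx with h | ⟨y, hy, h⟩
  · exact .inl h
  · exact .inr ⟨y, ⟨K, hy, ht, hp, hK⟩, h⟩

theorem not_isLiteralVar_this {σ : Scope} : ¬ IsLiteralVar P σ .this :=
  fun ⟨_, hx, ht, _⟩ => ht hx

theorem not_isLiteralVar_param {σ : Scope} {k : ℕ} : ¬ IsLiteralVar P σ (.param k) :=
  fun ⟨_, hx, _, hp, _⟩ => hp k hx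

/-- A node other than a variable that is assigned string constants only. -/
def NonLiteral (P : Program) (n : Node) : Prop :=
  ∀ σ x, n = .var σ x → ¬ IsLiteralVar P σ x

theorem nonLiteral_of_def {σ : Scope} {x : Local} {pc : ℕ} {s : Stmt}
    (hs : P.stmtAt (σ, pc) = some s) (hd : s.def? = some x)
    (hl : ∀ v, s ≠ .lit x v) (hc : ∀ y, s ≠ .copy x y) : NonLiteral P (.var σ x) := by
  rintro _ _ ⟨⟩ h
  rcases h.of_def hs hd with ⟨v, hv⟩ | ⟨y, -, hy⟩
  · exact hl v hv
  · exact hc y hy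

/-- Points-to facts are about objects of known class, variables that are assigned string constants
only point to string constants, and other variables receive the results of regular statements. -/
def Fact.Known (P : Program) : Fact → Prop
  | .pt n a => ¬ a.Unknown ∧
      (NonLiteral P n ∨ ∃ j, a = .obj j (some .javaLangString) ∧ litAt P j ≠ none)
  | .stmt (.load x _ _) => NonLiteral P x
  | .stmt (.call _ x _ _ _) => NonLiteral P x
  | _ => True

/-- Literal variables hold only string objects. This serves the inference rules that enlarge the
points-to set of a variable which their statement does not assign, where `nonLiteral_of_def` says
nothing. -/
theorem Fact.Known.var {n : Node} {a : AbsObj} (h : Fact.Known P (.pt n a))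
    (ha : ∀ j t, a ≠ .obj j t) : NonLiteral P n := by
  rcases h.2 with h | ⟨j, rfl, -⟩
  · exact h
  · exact absurd rfl (ha j _)

/-- The parts of `Fact.Known` need each other: `pForNameUnk` is refuted by what literal variables
point to, and this in turn needs that loads and calls, including the generated ones, have
non-literal targets. -/
theorem Derives.known (hP : RefJavaC P ex) {φ : Fact} (h : Derives P ex true φ) :
    φ.Known P := by
  induction h with
  | aNew hs | aNewArr hs | lKwTp hs =>
    exact ⟨by simp [AbsObj.Unknown], .inl (nonLiteral_of_def hs rfl (by simp) (by simp))⟩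
  | aLit hs => exact ⟨by simp [AbsObj.Unknown], .inr ⟨_, rfl, by simp [litAt, hs]⟩⟩
  | @aCpy σ pc x y a hs hy ih =>
    refine ⟨ih.1, ?_⟩
    -- A copy may write to a literal variable, but then its source is literal as well and passes on
    -- its constants.
    by_cases hx : IsLiteralVar P σ x
    · rcases hx.of_def hs rfl with ⟨v, hv⟩ | ⟨z, hz, he⟩
      · simp at hv
      · obtain rfl : y = z := by simpa using he
        exact .inr (ih.2.resolve_left fun h => h σ y rfl hz)
    · refine .inl ?_
      rintro _ _ ⟨⟩
      exact hx
  | aCast hs _ _ ih => exact ⟨ih.1, .inl (nonLiteral_of_def hs rfl (by simp) (by simp))⟩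
  | aALd hs _ _ _ ih => exact ⟨ih.1, .inl (nonLiteral_of_def hs rfl (by simp) (by simp))⟩
  | aASt _ _ _ _ ih => exact ⟨ih.1, .inl (by simp [NonLiteral])⟩
  | sLoad hs | sCall hs | tInvCall hs | tGet hs =>
    exact nonLiteral_of_def hs rfl (by simp) (by simp)
  | sStore | tSet | iPtp => trivial
  | aLd _ _ _ ihs _ ih => exact ⟨ih.1, .inl ihs⟩
  | aSt _ _ _ _ _ ih => exact ⟨ih.1, .inl (by simp [NonLiteral])⟩
  | aCallThis _ _ _ _ _ ih =>
    refine ⟨ih.1, .inl ?_⟩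
    rintro _ _ ⟨⟩
    exact not_isLiteralVar_this
  | aCallRet _ _ _ _ _ ihs _ ih => exact ⟨ih.1, .inl ihs⟩
  | aCallArg _ _ _ _ _ _ _ _ ih =>
    refine ⟨ih.1, .inl ?_⟩
    rintro _ _ ⟨⟩
    exact not_isLiteralVar_param
  | aCallToString _ _ _ _ ih | aCallGetClass _ _ _ _ ih => exact absurd rfl ih.1
  | pForNameConst hs =>
    exact ⟨by simp [AbsObj.Unknown], .inl (nonLiteral_of_def hs rfl (by simp) (by simp))⟩
  | @pForNameUnk σ pc c x j hs hx hl ih =>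
    exfalso
    -- In the syntactic case the induction hypothesis says that the string is a constant. In the
    -- semantic case the premise `hx` is itself membership in the points-to set that the hypothesis
    -- speaks of.
    rcases hP σ pc c x hs with hx' | h
    · obtain ⟨j', hj, hl'⟩ := ih.2.resolve_left fun h => h σ x rfl hx'
      obtain rfl : j = j' := by simpa using hj
      exact hl' hl
    · exact h j hx hl
  | pGetMtd hs _ _ _ ih | pGetFld hs _ _ _ ih =>
    exact ⟨ih.1, .inl (nonLiteral_of_def hs rfl (by simp) (by simp))⟩
  | iInvTp _ _ _ _ ih | iGetTp _ _ _ _ ih | iSetTp _ _ _ _ ih => exact absurd rfl ih.1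
  | iInvSig _ _ _ _ ih => exact ⟨ih.1, .inl (ih.var (by simp))⟩
  | iGetSig _ _ _ ih => exact ⟨ih.1, .inl (ih.var (by simp))⟩
  | iSetSig _ _ _ _ _ ih => exact ⟨ih.1, .inl (ih.var (by simp))⟩
  | iInvS2T _ _ _ _ _ _ _ _ _ ih => exact absurd rfl ih.1
  | iGetS2T _ _ _ _ _ _ _ ih => exact absurd rfl ih.1
  | iSetS2T _ _ _ _ _ _ _ _ _ _ ih => exact absurd rfl ih.1
  | tInvArg _ _ _ _ _ _ _ _ _ _ ih => exact ⟨ih.1, .inl (by simp [NonLiteral])⟩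
  | lUkwTp _ _ _ ih => exact absurd rfl ih.1
  | lCast _ _ _ _ _ ih => exact absurd rfl ih.1
  | lInv _ _ _ _ _ ih | lGet _ _ _ _ _ ih | lSet _ _ _ _ _ ih => exact absurd rfl ih.1

theorem Derives.not_unknown (hP : RefJavaC P ex) {n : Node} {a : AbsObj}
    (h : Derives P ex true (.pt n a)) : ¬ a.Unknown :=
  (h.known hP).1

/-! ### Dispensing with lazy heap modeling; origin of the objects of a site. -/

/-- The rules of lazy heap modeling can be switched on and, if there are no objects of unknown
class, off. -/
theorem Derives.change_lhm {lhm lhm' : Bool} {φ : Fact} (h : Derives P ex lhm φ)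
    (hu : lhm = true → ∀ n a, Derives P ex lhm (.pt n a) → ¬ a.Unknown) :
    Derives P ex lhm' φ := by
  induction h with
  | lUkwTp hl _ hc => exact absurd rfl (hu hl _ _ hc)
  | lCast hl _ _ hy => exact absurd rfl (hu hl _ _ hy)
  | lInv hl _ hy | lGet hl _ hy | lSet hl _ hy => exact absurd rfl (hu hl _ _ hy)
  | aNew => exact .aNew ‹_›
  | aLit => exact .aLit ‹_›
  | aNewArr => exact .aNewArr ‹_›
  | aCpy => apply Derives.aCpy <;> assumption
  | aCast => apply Derives.aCast <;> assumption
  | aALd => apply Derives.aALd <;> assumption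
  | aASt => apply Derives.aASt <;> assumption
  | sLoad => apply Derives.sLoad <;> assumption
  | sStore => apply Derives.sStore <;> assumption
  | sCall => exact .sCall ‹_›
  | aLd => apply Derives.aLd <;> assumption
  | aSt => apply Derives.aSt <;> assumption
  | aCallThis => apply Derives.aCallThis <;> assumption
  | aCallRet => apply Derives.aCallRet <;> assumption
  | aCallArg => apply Derives.aCallArg <;> assumption
  | aCallToString => apply Derives.aCallToString <;> assumption
  | aCallGetClass => apply Derives.aCallGetClass <;> assumption
  | pForNameConst => apply Derives.pForNameConst <;> assumption
  | pForNameUnk => apply Derives.pForNameUnk <;> assumption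
  | pGetMtd => apply Derives.pGetMtd <;> assumption
  | pGetFld => apply Derives.pGetFld <;> assumption
  | iPtp => apply Derives.iPtp <;> assumption
  | iInvTp => apply Derives.iInvTp <;> assumption
  | iInvSig => apply Derives.iInvSig <;> assumption
  | iInvS2T => apply Derives.iInvS2T <;> assumption
  | iGetTp => apply Derives.iGetTp <;> assumption
  | iGetSig => apply Derives.iGetSig <;> assumption
  | iGetS2T => apply Derives.iGetS2T <;> assumption
  | iSetTp => apply Derives.iSetTp <;> assumption
  | iSetSig => apply Derives.iSetSig <;> assumption
  | iSetS2T => apply Derives.iSetS2T <;> assumption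
  | tInvCall => apply Derives.tInvCall <;> assumption
  | tInvArg => apply Derives.tInvArg <;> assumption
  | tGet => apply Derives.tGet <;> assumption
  | tSet => apply Derives.tSet <;> assumption
  | lKwTp => apply Derives.lKwTp <;> assumption

/-- Switching off uses that nothing unknown is derivable. For switching on, the side condition of
`Derives.change_lhm` is vacuous, since the guarded rules do not occur in the given derivation. -/
theorem Derives.lhm_iff (hP : RefJavaC P ex) {φ : Fact} :
    Derives P ex true φ ↔ Derives P ex false φ :=
  ⟨fun h => h.change_lhm fun _ _ _ h' => h'.not_unknown hP, fun h => h.change_lhm (by simp)⟩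

/-- Rules that move an object keep its site and class, so only creation matters. Ordinary
allocations at this site contradict the statement found there; the `toString` rule and the rules of
lazy heap modeling contradict the absence of unknown classes; `lKwTp` remains. -/
theorem Derives.cls_of_newInstance (hP : RefJavaC P ex) {σ : Scope} {pc : ℕ} {o c : Local}
    (hs : P.stmtAt (σ, pc) = some (.newInstance o c)) {n : Node} {τ : Option ClassName}
    (h : Derives P ex true (.pt n (.obj (σ, pc) τ))) :
    ∃ t, τ = some t ∧ Derives P ex true (.pt (.var σ c) (.cls (some t))) := by
  -- The node must vary in the induction, because the object travels from node to node while its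
  -- site and class stay fixed.
  generalize hφ : Fact.pt n (.obj (σ, pc) τ) = φ at h
  induction h generalizing n with
  | aNew h' | aNewArr h' | aLit h' =>
    cases hφ
    simp [hs] at h'
  | aCallToString _ hy => exact absurd rfl (hy.not_unknown hP)
  | lUkwTp _ _ hc => exact absurd rfl (hc.not_unknown hP)
  | lCast _ _ _ hy => exact absurd rfl (hy.not_unknown hP)
  | lInv _ _ hy | lGet _ _ hy | lSet _ _ hy => exact absurd rfl (hy.not_unknown hP)
  | lKwTp h' hc =>
    cases hφ
    rw [hs] at h'
    cases h'
    exact ⟨_, rfl, hc⟩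
  | aCpy _ _ ih => cases hφ; exact ih rfl
  | aCast _ _ _ ih => cases hφ; exact ih rfl
  | aALd _ _ _ _ ih | aASt _ _ _ _ ih => cases hφ; exact ih rfl
  | aLd _ _ _ _ _ ih | aSt _ _ _ _ _ ih => cases hφ; exact ih rfl
  | aCallThis _ _ _ _ _ ih => cases hφ; exact ih rfl
  | aCallRet _ _ _ _ _ _ _ ih => cases hφ; exact ih rfl
  | aCallArg _ _ _ _ _ _ _ _ ih => cases hφ; exact ih rfl
  | tInvArg _ _ _ _ _ _ _ _ _ _ ih => cases hφ; exact ih rfl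
  | _ => cases hφ

/-! ### Coverage of run-time values by abstract objects. -/

theorem Covers.mono {h : Heap} {v : Val} {S T : Set AbsObj} (hv : Covers P h v S)
    (hST : S ⊆ T) : Covers P h v T := by
  cases v with
  | null => trivial
  | ref a => obtain ⟨o, ho, hS⟩ := hv; exact ⟨o, ho, hST hS⟩
  | cls t => exact hST hv
  | mtd m => obtain ⟨t, s, hS, hm⟩ := hv; exact ⟨t, s, hST hS, hm⟩
  | fld f => obtain ⟨t, s, hS, hf⟩ := hv; exact ⟨t, s, hST hS, hf⟩

/-- Coverage of a reference depends only on the site and class of its object, which later heaps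
preserve. -/
theorem Covers.extends {h h' : Heap} {v : Val} {S : Set AbsObj} (hv : Covers P h v S)
    (hh : h.Extends h') : Covers P h' v S := by
  cases v with
  | ref a =>
    obtain ⟨o, ho, hS⟩ := hv
    obtain ⟨o', ho', hs, hc⟩ := hh a o ho
    exact ⟨o', ho', by rwa [hs, hc]⟩
  | _ => exact hv

/-- The abstract objects of the dynamic type of `v` cover `v`. -/
theorem Covers.of_type {h : Heap} {v : Val} {t : ClassName} {S : Set AbsObj}
    (hv : Covers P h v S) (ht : typeOf h v = some t) :
    Covers P h v {a ∈ S | a.type = some t} := by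
  cases v with
  | null => trivial
  | ref a =>
    obtain ⟨o, ho, hS⟩ := hv
    refine ⟨o, ho, hS, ?_⟩
    simpa [typeOf, ho, AbsObj.type] using ht
  | cls _ => exact ⟨hv, ht⟩
  | mtd m => obtain ⟨t', s, hS, hm⟩ := hv; exact ⟨t', s, ⟨hS, ht⟩, hm⟩
  | fld f => obtain ⟨t', s, hS, hf⟩ := hv; exact ⟨t', s, ⟨hS, ht⟩, hf⟩

theorem Covers.nonempty {h : Heap} {v : Val} {S : Set AbsObj} (hv : Covers P h v S)
    (hn : v ≠ .null) : S.Nonempty := by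
  cases v with
  | null => exact absurd rfl hn
  | ref a => obtain ⟨o, -, hS⟩ := hv; exact ⟨_, hS⟩
  | cls t => exact ⟨_, hv⟩
  | mtd m => obtain ⟨t, s, hS, -⟩ := hv; exact ⟨_, hS⟩
  | fld f => obtain ⟨t, s, hS, -⟩ := hv; exact ⟨_, hS⟩

theorem Covers.exists_type {h : Heap} {v : Val} {t : ClassName} {S : Set AbsObj}
    (hv : Covers P h v S) (ht : typeOf h v = some t) : ∃ a ∈ S, a.type = some t := by
  refine (hv.of_type ht).nonempty ?_
  rintro rfl
  simp [typeOf] at ht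

theorem Covers.obj {h : Heap} {v : Val} {a : ℕ} {o : Obj} {S : Set AbsObj}
    (hv : Covers P h v S) (he : v = .ref a) (ho : h a = some o) :
    AbsObj.obj o.site (some o.cls) ∈ S := by
  subst he
  obtain ⟨o', ho', hS⟩ := hv
  obtain rfl : o' = o := by simpa [ho] using ho'.symm
  exact hS

theorem Covers.cls {h : Heap} {v : Val} {t : ClassName} {S : Set AbsObj}
    (hv : Covers P h v S) (he : v = .cls t) : AbsObj.cls (some t) ∈ S := by
  subst he
  exact hv

theorem Covers.mtd {h : Heap} {v : Val} {m : Method} {S : Set AbsObj}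
    (hv : Covers P h v S) (he : v = .mtd m) :
    ∃ t s, AbsObj.mtd (some t) s ∈ S ∧ m ∈ MTD P t s := by
  subst he
  exact hv

theorem Covers.fld {h : Heap} {v : Val} {f : RefJava.Field} {S : Set AbsObj}
    (hv : Covers P h v S) (he : v = .fld f) :
    ∃ t s, AbsObj.fld (some t) s ∈ S ∧ f ∈ FLD P t s := by
  subst he
  exact hv

/-! ### The simulation invariant and its stability under heap updates. -/

variable (P ex)

/-- The strings of constants are those of their sites, and the points-to sets cover the fields and
the elements of `o`. -/
structure SoundObj (h : Heap) (o : Obj) : Prop where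
  cls : o.str ≠ none → o.cls = .javaLangString
  lit : ∀ v, litAt P o.site = some v → o.str = some v
  fields : ∀ f, Covers P h (o.fields f) (pt P ex (.field (.obj o.site (some o.cls)) f))
  elems : ∀ vs, o.elems = some vs → ∀ v ∈ vs,
    Covers P h v (pt P ex (.arr (.obj o.site (some o.cls))))

def SoundHeap (h : Heap) : Prop :=
  ∀ a o, h a = some o → SoundObj P ex h o

def SoundEnv (h : Heap) (σ : Scope) (e : Env) : Prop :=
  ∀ x, Covers P h (e x) (pt P ex (.var σ x))

/-- The values returned by the frame `fr` are covered in the frame `gr` of its caller. -/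
def ReturnFlow (fr gr : Frame) : Prop :=
  ∀ s x, P.stmtAt (gr.scope, gr.pc) = some s → s.def? = some x →
    pt P ex (.var fr.scope .ret) ⊆ pt P ex (.var gr.scope x)

/-- The chain condition stores the return flow established when each call was entered. On return,
the receiver and the dispatch that justified the flow are no longer visible in the state. -/
structure SoundState (st : State) : Prop where
  heap : SoundHeap P ex st.heap
  env : ∀ fr ∈ st.stack, SoundEnv P ex st.heap fr.scope fr.env
  chain : st.stack.IsChain (ReturnFlow P ex)

variable {P ex}

theorem SoundObj.extends {h h' : Heap} {o : Obj} (ho : SoundObj P ex h o)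
    (hh : h.Extends h') : SoundObj P ex h' o :=
  ⟨ho.cls, ho.lit, fun f => (ho.fields f).extends hh,
    fun vs hvs v hv => (ho.elems vs hvs v hv).extends hh⟩

theorem SoundEnv.extends {h h' : Heap} {σ : Scope} {e : Env} (he : SoundEnv P ex h σ e)
    (hh : h.Extends h') : SoundEnv P ex h' σ e :=
  fun x => (he x).extends hh

theorem SoundEnv.update {h : Heap} {σ : Scope} {e : Env} (he : SoundEnv P ex h σ e)
    {x : Local} {v : Val} (hv : Covers P h v (pt P ex (.var σ x))) :
    SoundEnv P ex h σ (Function.update e x v) := by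
  intro y
  by_cases hy : y = x
  · subst hy
    simpa using hv
  · simpa [hy] using he y

theorem SoundHeap.update {h : Heap} (hh : SoundHeap P ex h) {a : ℕ} {o : Obj}
    (hext : h.Extends (Function.update h a (some o))) (ho : SoundObj P ex h o) :
    SoundHeap P ex (Function.update h a (some o)) := by
  intro b p hb
  by_cases hne : b = a
  · subst hne
    obtain rfl : o = p := by simpa using hb
    exact ho.extends hext
  · exact (hh b p (by simpa [hne] using hb)).extends hext

/-- Allocation of an object with null fields and null elements. -/
theorem SoundHeap.alloc {h : Heap} (hh : SoundHeap P ex h) {σ : Scope} {e : Env}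
    (he : SoundEnv P ex h σ e) {a : ℕ} (ha : h a = none) {i : Site} {t : ClassName}
    {s : Option Str} {vs : Option (List Val)} {x : Local}
    (hs : s ≠ none → t = .javaLangString) (hl : ∀ v, litAt P i = some v → s = some v)
    (hvs : ∀ ws, vs = some ws → ∀ v ∈ ws, v = .null)
    (hx : AbsObj.obj i (some t) ∈ pt P ex (.var σ x)) :
    let h' := Function.update h a (some ⟨i, t, s, fun _ => .null, vs⟩)
    h.Extends h' ∧ SoundHeap P ex h' ∧
      SoundEnv P ex h' σ (Function.update e x (.ref a)) := by
  have hext := Heap.extends_alloc ha ⟨i, t, s, fun _ => .null, vs⟩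
  refine ⟨hext, hh.update hext ⟨hs, hl, fun _ => trivial, fun ws hws v hv => ?_⟩,
    (he.extends hext).update ⟨_, Function.update_self .., hx⟩⟩
  rw [hvs ws hws v hv]
  trivial

/-- The rules for reflective names fire only on abstract objects of class `String`, and they read
the name from the allocation site. The fields `cls` and `lit` of `SoundObj` provide exactly these
two links; a site without a constant imposes nothing. -/
theorem SoundHeap.litAt_of_isStr {h : Heap} (hh : SoundHeap P ex h) {v : Val} {s : Str}
    {S : Set AbsObj} (hv : Covers P h v S) (hs : IsStr h v s) :
    ∃ j, AbsObj.obj j (some .javaLangString) ∈ S ∧ ∀ u, litAt P j = some u → u = s := by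
  obtain ⟨a, o, he, ho, hstr⟩ := hs
  have hmem := hv.obj he ho
  rw [(hh a o ho).cls (by simp [hstr])] at hmem
  refine ⟨_, hmem, fun u hu => ?_⟩
  have := (hh a o ho).lit u hu
  rw [hstr] at this
  simpa using this.symm

/-- Tailored to the signatures produced by `pGetMtd`: return type and parameters are wild cards, and
only the name can restrict the search. -/
theorem mem_MTD {t : ClassName} {s : MSig} {m : Method} (hsub : P.Sub t m.decl)
    (hm : P.DeclaresMethod m) (hr : s.ret = none) (hn : ∀ n, s.name = some n → m.name = n)
    (hp : s.params = none) : m ∈ MTD P t s :=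
  Set.mem_biUnion (x := m.decl) hsub ⟨rfl, hm, by simp [hr], hn, by simp [hp]⟩

theorem mem_FLD {t : ClassName} {s : FSig} {f : RefJava.Field} (hsub : P.Sub t f.decl)
    (hf : P.DeclaresField f) (hr : s.type = none) (hn : ∀ n, s.name = some n → f.name = n) :
    f ∈ FLD P t s :=
  Set.mem_biUnion (x := f.decl) hsub ⟨rfl, hf, by simp [hr], hn⟩

/-- An update of the fields or elements of an object. -/
theorem SoundHeap.modify {h : Heap} (hh : SoundHeap P ex h) {σ : Scope} {e : Env}
    (he : SoundEnv P ex h σ e) {a : ℕ} {o o' : Obj} (ha : h a = some o)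
    (hs : o'.site = o.site) (hc : o'.cls = o.cls) (ho : SoundObj P ex h o') :
    let h' := Function.update h a (some o')
    h.Extends h' ∧ SoundHeap P ex h' ∧ SoundEnv P ex h' σ e :=
  have hext := Heap.extends_update ha hs hc
  ⟨hext, hh.update hext ho, he.extends hext⟩

/-- The store enters as a derived fact between arbitrary nodes, so that ordinary stores and those
generated from `set` are treated alike. -/
theorem SoundObj.set_field {h : Heap} {o : Obj} (ho : SoundObj P ex h o) {f : RefJava.Field}
    {v : Val} {n m : Node} (hst : Derives P ex true (.stmt (.store n f m)))
    (hn : AbsObj.obj o.site (some o.cls) ∈ pt P ex n) (hv : Covers P h v (pt P ex m)) :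
    SoundObj P ex h { o with fields := Function.update o.fields f v } := by
  refine ⟨ho.cls, ho.lit, fun g => ?_, ho.elems⟩
  by_cases hg : g = f
  · subst hg
    simpa using hv.mono fun _ hb => .aSt hst hn hb
  · simpa [hg] using ho.fields g

theorem SoundObj.set_elem {h : Heap} {o : Obj} (ho : SoundObj P ex h o) {vs : List Val}
    {k : ℕ} {v : Val} (hvs : o.elems = some vs)
    (hv : Covers P h v (pt P ex (.arr (.obj o.site (some o.cls))))) :
    SoundObj P ex h { o with elems := some (vs.set k v) } := by
  refine ⟨ho.cls, ho.lit, ho.fields, ?_⟩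
  rintro _ ⟨⟩ w hw
  rcases List.mem_or_eq_of_mem_set hw with hw | rfl
  · exact ho.elems vs hvs w hw
  · exact hv

/-! ### Preservation of the invariant by execution steps. -/

theorem SoundHeap.eval (hP : RefJavaC P ex) {σ : Scope} {pc : ℕ} {h h' : Heap} {e e' : Env}
    {s : Stmt} {ev : Event} (hh : SoundHeap P ex h) (he : SoundEnv P ex h σ e)
    (hs : P.stmtAt (σ, pc) = some s) (hev : Eval P (σ, pc) h e s ev h' e') :
    h.Extends h' ∧ SoundHeap P ex h' ∧ SoundEnv P ex h' σ e' := by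
  have stay {x v} (hv : Covers P h v (pt P ex (.var σ x))) :
      h.Extends h ∧ SoundHeap P ex h ∧ SoundEnv P ex h σ (Function.update e x v) :=
    ⟨.refl h, hh, he.update hv⟩
  cases hev with
  | new _ _ ha hf =>
    -- The statement at this site is no string constant, so `litAt` is `none` there and the
    -- condition on constants is vacuous.
    exact hh.alloc he ha (fun h => hf.1 (Option.isSome_iff_ne_none.2 h)) (by simp [litAt, hs])
      (by simp) (.aNew hs)
  | copy => exact stay ((he _).mono fun _ ha => .aCpy hs ha)
  | load hy ho =>
    exact stay (((hh _ _ ho).fields _).mono fun _ ha => .aLd (.sLoad hs) ((he _).obj hy ho) ha)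
  | store hx ho =>
    exact hh.modify he ho rfl rfl
      ((hh _ _ ho).set_field (.sStore hs) ((he _).obj hx ho) (he _))
  | lit ha =>
    exact hh.alloc he ha (fun _ => rfl) (by simp [litAt, hs]) (by simp) (.aLit hs)
  | newArr n ha =>
    exact hh.alloc he ha (by simp) (by simp [litAt, hs]) (by simp) (.aNewArr hs)
  | aload hy ho hvs hv =>
    exact stay (((hh _ _ ho).elems _ hvs _ hv).mono fun _ ha => .aALd hs ((he _).obj hy ho) ha)
  | astore hx ho hvs =>
    exact hh.modify he ho rfl rfl ((hh _ _ ho).set_elem hvs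
      ((he _).mono fun _ ha => .aASt hs ((he _).obj hx ho) ha))
  | cast =>
    -- The cast filter blocks only objects of unknown type, and there are none.
    refine stay ((he _).mono fun a ha => .aCast hs ha (.inr ?_))
    rintro i rfl
    exact Derives.not_unknown hP ha rfl
  | forName hstr ht =>
    obtain ⟨j, hj, hu⟩ := hh.litAt_of_isStr (he _) hstr
    refine stay ?_
    -- A non-constant string here would let `pForNameUnk` derive a Class object of unknown class. So
    -- the string is a constant, and its value is the name found at run time.
    cases hl : litAt P j with
    | none => exact absurd rfl (Derives.not_unknown hP (.pForNameUnk hs hj hl))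
    | some u =>
      obtain rfl := hu u hl
      exact Derives.pForNameConst hs hj hl ht
  | getMethod hc hstr _ hm =>
    obtain ⟨j, hj, hu⟩ := hh.litAt_of_isStr (he _) hstr
    -- Covering the Class object gives a known class; the run-time search only climbs to supertypes,
    -- which is where `MTD` looks. A name known to the analysis equals the run-time name.
    exact stay ⟨_, _, .pGetMtd hs hj ((he _).cls hc), mem_MTD (Program.sub_of_methodHome hm.1)
      hm.2.1 rfl (fun u hl => hm.2.2.1.trans (hu u hl).symm) rfl⟩
  | getField hc hstr hf =>
    obtain ⟨j, hj, hu⟩ := hh.litAt_of_isStr (he _) hstr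
    exact stay ⟨_, _, .pGetFld hs hj ((he _).cls hc), mem_FLD (Program.sub_of_fieldHome hf.1)
      hf.2.1 rfl (fun u hl => hf.2.2.trans (hu u hl).symm)⟩
  | newInstance hc _ _ ha hf =>
    exact hh.alloc he ha (fun h => hf.1 (Option.isSome_iff_ne_none.2 h)) (by simp [litAt, hs])
      (by simp) (.lKwTp hs ((he _).cls hc))
  | get hf hy ho =>
    obtain ⟨t, s, ht, hft⟩ := (he _).fld hf
    exact stay (((hh _ _ ho).fields _).mono fun _ ha =>
      .aLd (.tGet hs ht hft) ((he _).obj hy ho) ha)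
  | set hf hy ho =>
    obtain ⟨t, s, ht, hft⟩ := (he _).fld hf
    exact hh.modify he ho rfl rfl
      ((hh _ _ ho).set_field (.tSet hs ht hft) ((he _).obj hy ho) (he _))

/-- Entering a method from an ordinary call or from a call created by the transformation. -/
theorem SoundState.enter {h : Heap} {fr : Frame} {fs : List Frame}
    (hst : SoundState P ex ⟨h, fr :: fs⟩) {s : Stmt} {x y : Local} {m m' : Method}
    {args : List Node} {t : ClassName} {vs : List Val}
    (hs : P.stmtAt (fr.scope, fr.pc) = some s) (hx : s.def? = some x)
    (hc : Derives P ex true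
      (.stmt (.call (fr.scope, fr.pc) (.var fr.scope x) (.var fr.scope y) m args)))
    (ht : typeOf h (fr.env y) = some t) (hd : P.Dispatch t m m')
    (hargs : ∀ (k : ℕ) (v : Val), vs[k]? = some v → ∃ n, args[k]? = some n ∧ Covers P h v (pt P ex n)) :
    SoundState P ex ⟨h, ⟨.meth m', 0, entryEnv (fr.env y) vs⟩ :: fr :: fs⟩ := by
  have hy : Covers P h (fr.env y) (pt P ex (.var fr.scope y)) := hst.env fr (by simp) y
  -- An abstract receiver of the same dynamic type dispatches to the same method; it enables the
  -- rules for arguments and return value.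
  obtain ⟨o, ho, hot⟩ := hy.exists_type ht
  refine ⟨hst.heap, ?_, List.isChain_cons_cons.2 ⟨?_, hst.chain⟩⟩
  · intro gr hgr
    rcases List.mem_cons.1 hgr with rfl | hgr
    · rintro (_ | k | _ | _)
      -- Only receivers whose own type dispatches to `m'` flow to `this`, so the covering set is
      -- first cut down to objects of type `t`.
      · exact (hy.of_type ht).mono fun a ha => .aCallThis hc ha.1 ha.2 hd
      -- Parameters beyond the supplied arguments default to null, which needs no covering.
      · cases hv : vs[k]? with
        | none => simp [entryEnv, hv, Covers]
        | some v =>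
          obtain ⟨n, hn, hcov⟩ := hargs k v hv
          simpa [entryEnv, hv] using hcov.mono fun a ha => .aCallArg hc ho hot hd hn ha
      · trivial
      · trivial
    · exact hst.env gr hgr
  · intro s' x' hs' hx'
    obtain rfl : s = s' := by simpa [hs] using hs'
    obtain rfl : x = x' := by simpa [hx] using hx'
    exact fun a ha => .aCallRet hc ho hot hd ha

/-- The arguments that `invoke` passes to its target are covered by those of the call created by
the transformation. -/
theorem covers_invoke_args {h : Heap} {σ : Scope} {e : Env} (hh : SoundHeap P ex h)
    (he : SoundEnv P ex h σ e) {pc : ℕ} {x m y args : Local} {A t : ClassName} {s : MSig}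
    {m' : Method} {vs : List Val} (hs : P.stmtAt (σ, pc) = some (.invoke x A m y args))
    (hm : AbsObj.mtd (some t) s ∈ pt P ex (.var σ m)) (ht : m' ∈ MTD P t s)
    (hargs : IsArgs h (e args) vs) (hfit : List.Forall₂ (Fits P h) m'.params vs)
    (k : ℕ) (v : Val) (hv : vs[k]? = some v) :
    ∃ n, ((List.range m'.params.length).map (Node.arg (σ, pc) m'))[k]? = some n ∧
      Covers P h v (pt P ex n) := by
  obtain ⟨hk, rfl⟩ := List.getElem?_eq_some_iff.1 hv
  have hk' : k < m'.params.length := hfit.length_eq ▸ hk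
  refine ⟨.arg (σ, pc) m' k, by simp [hk'], ?_⟩
  -- The run-time check of an argument against its parameter type is the filter of `tInvArg`: a
  -- non-null value passing it has a type below the parameter type, and so do the abstract objects
  -- of that type.
  rcases (List.forall₂_iff_get.1 hfit).2 k hk' hk with hnull | ⟨t', ht', hsub⟩
  · rw [List.get_eq_getElem] at hnull
    rw [hnull]
    trivial
  · rcases hargs with ⟨-, rfl⟩ | ⟨a, o, hea, ho, hvs⟩
    · simp at hk
    · have hcov := (hh a o ho).elems vs hvs _ (List.getElem_mem hk)
      exact (hcov.of_type ht').mono fun b hb => .tInvArg hs hm ht ((he _).obj hea ho) hb.1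
        (List.getElem?_eq_getElem hk') hb.2 hsub

theorem SoundState.step (hP : RefJavaC P ex) {st st' : State} {ev : Event}
    (hst : SoundState P ex st) (h : Step P st ev st') : SoundState P ex st' := by
  cases h with
  | @eval h fr fs s nxt ev h' e' pc' hi hev hpc =>
    obtain ⟨hext, hh, he⟩ := hst.heap.eval hP (hst.env fr (by simp))
      (Program.stmtAt_of_instrAt hi) hev
    refine ⟨hh, ?_, ?_⟩
    · intro gr hgr
      rcases List.mem_cons.1 hgr with rfl | hgr
      · exact he
      · exact (hst.env gr (by simp [hgr])).extends hext
    · have := hst.chain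
      -- `ReturnFlow` depends on the upper frame only through its scope, and on a program counter
      -- only for suspended callers. Advancing the top frame therefore leaves the chain condition
      -- unchanged by definition.
      rw [List.isChain_cons] at this ⊢
      exact this
  | call hi ht hd hb =>
    have hs := Program.stmtAt_of_instrAt hi
    refine hst.enter hs rfl (.sCall hs) ht hd fun k v hv => ?_
    rw [List.getElem?_map, Option.map_eq_some_iff] at hv
    obtain ⟨z, hz, rfl⟩ := hv
    exact ⟨.var _ z, by simp [hz], hst.env _ List.mem_cons_self z⟩
  | @invoke h fr fs x A m y args nxt t m' m'' vs hi hm ht hsub hargs hfit hd hb =>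
    have hs := Program.stmtAt_of_instrAt hi
    have he : SoundEnv P ex h fr.scope fr.env := hst.env fr (by simp)
    obtain ⟨t₀, s, hmt, hmem⟩ := (he m).mtd hm
    exact hst.enter hs rfl (.tInvCall hs hmt hmem) ht hd
      (covers_invoke_args hst.heap he hs hmt hmem hargs hfit)
  | @ret h fr gr fs s nxt x pc' hend hi hr hpc =>
    obtain ⟨hflow, hchain⟩ := List.isChain_cons_cons.1 hst.chain
    refine ⟨hst.heap, ?_, ?_⟩
    · intro kr hkr
      rcases List.mem_cons.1 hkr with rfl | hkr
      -- The returned value is covered at the callee's `ret`, and the stored return flow carries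
      -- this to the variable assigned by the call.
      · exact SoundEnv.update (hst.env gr (by simp)) ((hst.env fr (by simp) .ret).mono
          (hflow s x (Program.stmtAt_of_instrAt hi) hr.def?))
      · exact hst.env kr (by simp [hkr])
    · rw [List.isChain_cons] at hchain ⊢
      exact hchain

theorem soundState_init : SoundState P ex initState := by
  refine ⟨by simp [SoundHeap, initState], ?_, by simp [initState]⟩
  intro fr hfr
  obtain rfl := List.mem_singleton.1 hfr
  exact fun x => trivial

/-! ### Reachable states, call edges and reflective targets. -/

theorem SoundState.of_reachable (hP : RefJavaC P ex) {st : State} (h : Reachable P st) :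
    SoundState P ex st := by
  induction h with
  | refl => exact soundState_init
  | tail _ h ih => exact ih.step hP h.choose_spec

theorem SoundState.callEdge_of_call {st st' : State} (hst : SoundState P ex st) {i : Site}
    {m : Method} (h : Step P st (.call i m) st') : CallEdge P ex i m := by
  cases h with
  | eval _ he => cases he
  | @call h fr _ _ y _ _ _ _ _ hi ht hd =>
    have hcov : Covers P h _ _ := hst.env fr (by simp) y
    obtain ⟨o, ho, hot⟩ := hcov.exists_type ht
    exact ⟨_, _, _, _, .sCall (Program.stmtAt_of_instrAt hi), o, ho, _, hot, hd⟩

/-- Two different methods are involved: the target comes from coverage of the Method object, whereas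
the callee arises by dispatching the generated call on the receiver's dynamic type. -/
theorem SoundState.targets_of_invoke {st st' : State} (hst : SoundState P ex st) {i : Site}
    {m m' : Method} (h : Step P st (.invoke i m m') st') :
    m ∈ methodTargets P ex i ∧ CallEdge P ex i m' := by
  cases h with
  | eval _ he => cases he
  | @invoke h fr _ _ _ r y _ _ _ _ _ _ hi hm ht _ _ _ hd =>
    have hs := Program.stmtAt_of_instrAt hi
    have he : SoundEnv P ex h fr.scope fr.env := hst.env fr (by simp)
    obtain ⟨t₀, s, hmt, hmem⟩ := (he r).mtd hm
    obtain ⟨o, ho, hot⟩ := (he y).exists_type ht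
    exact ⟨⟨_, _, _, _, _, hs, t₀, s, hmt, hmem⟩,
      ⟨_, _, _, _, .tInvCall hs hmt hmem, o, ho, _, hot, hd⟩⟩

theorem SoundState.classTargets_of_newInstance {st st' : State} (hst : SoundState P ex st)
    {i : Site} {t : ClassName} (h : Step P st (.newInstance i t) st') :
    t ∈ classTargets P ex i := by
  cases h with
  | @eval h fr _ _ _ _ _ _ _ hi he =>
    cases he with
    | newInstance hc =>
      exact ⟨_, _, Program.stmtAt_of_instrAt hi, (hst.env fr (by simp) _).cls hc⟩

theorem SoundState.fieldTargets_of_get {st st' : State} (hst : SoundState P ex st) {i : Site}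
    {f : RefJava.Field} (h : Step P st (.get i f) st') : f ∈ fieldTargets P ex i := by
  cases h with
  | @eval h fr _ _ _ _ _ _ _ hi he =>
    cases he with
    | get hf =>
      exact ⟨_, _, .inl ⟨_, _, Program.stmtAt_of_instrAt hi⟩, (hst.env fr (by simp) _).fld hf⟩

theorem SoundState.fieldTargets_of_set {st st' : State} (hst : SoundState P ex st) {i : Site}
    {f : RefJava.Field} (h : Step P st (.set i f) st') : f ∈ fieldTargets P ex i := by
  cases h with
  | @eval h fr _ _ _ _ _ _ _ hi he =>
    cases he with
    | set hf =>
      exact ⟨_, _, .inr ⟨_, Program.stmtAt_of_instrAt hi⟩, (hst.env fr (by simp) _).fld hf⟩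

theorem sound (hP : RefJavaC P ex) : Sound P ex where
  vars _ hst := (SoundState.of_reachable hP hst).env
  fields _ hst a o ho := ((SoundState.of_reachable hP hst).heap a o ho).fields
  elems _ hst a o ho := ((SoundState.of_reachable hP hst).heap a o ho).elems
  calls _ _ _ _ hst h := (SoundState.of_reachable hP hst).callEdge_of_call h
  newInstances _ _ _ _ hst h := (SoundState.of_reachable hP hst).classTargets_of_newInstance h
  invokes _ _ _ _ _ hst h := (SoundState.of_reachable hP hst).targets_of_invoke h
  gets _ _ _ _ hst h := (SoundState.of_reachable hP hst).fieldTargets_of_get h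
  sets _ _ _ _ hst h := (SoundState.of_reachable hP hst).fieldTargets_of_set h

end Solar

theorem lemma2 (P : RefJava.Program) (ex : RefJava.Site → Option (List RefJava.Local))
    (hP : Solar.RefJavaC P ex) :
    -- the analysis is sound
    Solar.Sound P ex ∧
    -- nothing of unknown class is ever created, so the rules of lazy heap modeling are not needed
    (∀ n, ∀ a ∈ Solar.pt P ex n, ¬ a.Unknown) ∧
    (∀ φ, Solar.Derives P ex true φ ↔ Solar.Derives P ex false φ) ∧
    -- a call `o = c.newInstance()` at `i` amounts to the allocations `i : o = new t()` for the
    -- classes `t` that `c` points to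
    (∀ σ pc o c, P.stmtAt (σ, pc) = some (.newInstance o c) →
      (∀ t, Solar.AbsObj.cls (some t) ∈ Solar.pt P ex (.var σ c) →
        Solar.AbsObj.obj (σ, pc) (some t) ∈ Solar.pt P ex (.var σ o)) ∧
      ∀ n τ, Solar.AbsObj.obj (σ, pc) τ ∈ Solar.pt P ex n →
        ∃ t, τ = some t ∧ Solar.AbsObj.cls (some t) ∈ Solar.pt P ex (.var σ c)) :=
  ⟨Solar.sound hP, fun _ _ ha => Solar.Derives.not_unknown hP ha,
    fun _ => Solar.Derives.lhm_iff hP,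
    fun _ _ _ _ hs => ⟨fun _ ht => .lKwTp hs ht, fun _ _ h => h.cls_of_newInstance hP hs⟩⟩
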